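/- A family $\mathcal H$ of partial functions from $\omega$ to $\omega$ is *coherent* if $\{n\in\mathrm{dom}(f)\cap\mathrm{dom}(g): f(n)\neq g(n)\}$ is finite for all $f,g\in\mathcal H$. Let $\mathcal H=\{h_\alpha:\alpha<\omega_1\}$ be a coherent family of partial functions from $\omega$ to $\omega$ such that $\mathrm{dom}(h_\alpha)\setminus\mathrm{dom}(h_\beta)$ is finite for all $\alpha<\beta<\omega_1$, and such that there is no total function $h\in\omega^\omega$ for which $\mathcal H\cup\{h\}$ is coherent. Let $Q(\mathcal H)$ be the poset of all pairs $q=(\{s^q_\rho:\rho\in 2^{\le n_q}\},\Gamma_q)$ such that 1. $n_q\in\omega$, each $s^q_\rho$ is a finite subset of $\omega$, and $\Gamma_q$ is a finite subset of $\omega_1$; 2. for all $\alpha\ne\beta$ in $\Gamma_q$ and $\rho\in 2^{n_q}$, the union $(h_\alpha\restriction s^q_\rho)\cup(h_\beta\restriction s^q_\rho)$ is not a function; 3. for each $\rho\in 2^{n_q}$, $s^q_{\rho\restriction j}\subseteq s^q_{\rho\restriction k}$ whenever $j\le k\le n_q$; 4. for all $\rho,\psi\in 2^{n_q}$, $s^q_\rho\cap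 s^q_\psi=s^q_{\rho\restriction j}$, where $j\le n_q$ is maximal with $\rho\restriction j=\psi\restriction j$; ordered by $q\le r$ if and only if $n_q\ge n_r$, $\Gamma_q\supseteq\Gamma_r$ and $s^q_\rho=s^r_\rho$ for all $\rho\in 2^{n_r}$. Then $Q(\mathcal H)$ is ccc (every antichain is countable). Furthermore, there is a condition $q\in Q(\mathcal H)$ which forces that there are an uncountable $\Gamma\subseteq\omega_1$ and an uncountable almost disjoint family $\mathcal A$ of infinite subsets of $\omega$ such that, for each $a\in\mathcal A$, the family $\{h_\alpha\restriction a:\alpha\in\Gamma\}$ is Luzin incoherent, that is, for all $\alpha<\beta$ in $\Gamma$ the union $(h_\alpha\restriction a)\cup(h_\beta\restriction a)$ is not a function. -/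

import Mathlib

/-! ## Coherent families of partial functions -/

/-- The first uncountable ordinal, as a well-ordered type. -/
abbrev Omega1 : Type := (Ordinal.omega 1 : Ordinal.{0}).ToType

/-- A family of partial functions on `ω` is coherent if any two members differ at only finitely
many points of their common domain. -/
def Coherent (H : Set (ℕ →. ℕ)) : Prop :=
  ∀ f ∈ H, ∀ g ∈ H, {n : ℕ | ∃ x ∈ f n, ∃ y ∈ g n, x ≠ y}.Finite

/-- The domains of `h α` increase modulo finite sets. -/
def ModFiniteIncreasingDoms (h : Omega1 → (ℕ →. ℕ)) : Prop :=
  ∀ α β : Omega1, α < β → ((h α).Dom \ (h β).Dom).Finite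

/-- The set of pairs `(f ↾ s) ∪ (g ↾ s)`. -/
def unionRestrict (f g : ℕ →. ℕ) (s : Set ℕ) : Set (ℕ × ℕ) :=
  {z | z.1 ∈ s ∧ (z.2 ∈ f z.1 ∨ z.2 ∈ g z.1)}

/-- A set of pairs is (the graph of) a function. -/
def IsFunctionGraph (R : Set (ℕ × ℕ)) : Prop :=
  ∀ n x y, (n, x) ∈ R → (n, y) ∈ R → x = y

/-! ## Partial orders as forcing notions -/

/-- Two conditions are compatible if they have a common extension. -/
def Compatible {P : Type*} [Preorder P] (p q : P) : Prop :=
  ∃ r : P, r ≤ p ∧ r ≤ q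

/-- The countable chain condition: every antichain is countable. -/
def IsCCC (P : Type*) [Preorder P] : Prop :=
  ∀ A : Set P, (∀ p ∈ A, ∀ q ∈ A, p ≠ q → ¬ Compatible p q) → A.Countable

/-! ## The poset `Q(H)` -/

/-- Conditions of `Q(H)` for `H = {h α : α < ω₁}`. Finite binary sequences are lists of Booleans and
`ρ ↾ j` is `ρ.take j`. The system `s ρ` is indexed by the sequences of length at most `n`; the
field `s_out` only fixes the irrelevant values at longer lists. -/
@[ext]
structure QPoset (h : Omega1 → (ℕ →. ℕ)) where
  n : ℕ
  s : List Bool → Finset ℕ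
  Γ : Finset Omega1
  s_out : ∀ ρ : List Bool, n < ρ.length → s ρ = ∅
  not_function : ∀ α ∈ Γ, ∀ β ∈ Γ, α ≠ β → ∀ ρ : List Bool, ρ.length = n →
    ¬ IsFunctionGraph (unionRestrict (h α) (h β) (s ρ))
  increasing : ∀ ρ : List Bool, ρ.length = n → ∀ j k : ℕ, j ≤ k → k ≤ n →
    s (ρ.take j) ⊆ s (ρ.take k)
  inter_eq : ∀ ρ ψ : List Bool, ρ.length = n → ψ.length = n → ∀ j : ℕ,
    IsGreatest {i : ℕ | i ≤ n ∧ ρ.take i = ψ.take i} j → s ρ ∩ s ψ = s (ρ.take j)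

namespace QPoset

variable {h : Omega1 → (ℕ →. ℕ)}

/-- `q` extends `r`. -/
protected def le (q r : QPoset h) : Prop :=
  r.n ≤ q.n ∧ r.Γ ⊆ q.Γ ∧ ∀ ρ : List Bool, ρ.length = r.n → q.s ρ = r.s ρ

/-- The values at the top level determine all the values below: a node of smaller length is
the splitting node of two sequences of full length. -/
theorem exists_split (r : QPoset h) (σ : List Bool) (hσ : σ.length < r.n) :
    ∃ ρ ψ : List Bool, ρ.length = r.n ∧ ψ.length = r.n ∧ ρ.take σ.length = σ ∧
      IsGreatest {i : ℕ | i ≤ r.n ∧ ρ.take i = ψ.take i} σ.length := by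
  refine ⟨σ ++ true :: List.replicate (r.n - σ.length - 1) true,
    σ ++ false :: List.replicate (r.n - σ.length - 1) true, ?_, ?_, ?_, ⟨?_, ?_⟩, ?_⟩
  · simp; omega
  · simp; omega
  · simp
  · omega
  · simp
  · rintro i ⟨_, hi⟩
    by_contra hlt
    push Not at hlt
    have := congrArg (fun l : List Bool => l[σ.length]?) hi
    simp [hlt] at this

theorem s_eq_of_le {q r : QPoset h} (hqr : QPoset.le q r) (σ : List Bool)
    (hσ : σ.length ≤ r.n) : q.s σ = r.s σ := by
  obtain ⟨hn, _, hs⟩ := hqr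
  rcases hσ.eq_or_lt with heq | hlt
  · exact hs σ heq
  obtain ⟨ρ, ψ, hρ, hψ, hσρ, hg⟩ := r.exists_split σ hlt
  have e1 := r.inter_eq ρ ψ hρ hψ _ hg
  rw [hσρ] at e1
  have pad : ∀ (τ : List Bool), τ.length = r.n →
      (τ ++ List.replicate (q.n - r.n) true).length = q.n := by
    intro τ hτ; simp; omega
  -- pass to sequences of length `q.n` and use that the systems increase along branches
  have sub : ∀ τ : List Bool, τ.length = r.n →
      q.s τ ⊆ q.s (τ ++ List.replicate (q.n - r.n) true) ∧
      q.s (τ.take σ.length) ⊆ q.s τ := by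
    intro τ hτ
    have h1 := q.increasing _ (pad τ hτ) r.n q.n hn le_rfl
    have h2 := q.increasing _ (pad τ hτ) σ.length r.n hlt.le hn
    rw [List.take_of_length_le (pad τ hτ).le, List.take_append_of_le_length hτ.ge,
      List.take_of_length_le hτ.le] at h1
    rw [List.take_append_of_le_length (by omega), List.take_append_of_le_length hτ.ge,
      List.take_of_length_le hτ.le] at h2
    exact ⟨h1, h2⟩
  have hg' : IsGreatest {i : ℕ | i ≤ q.n ∧
      (ρ ++ List.replicate (q.n - r.n) true).take i =
      (ψ ++ List.replicate (q.n - r.n) true).take i} σ.length := by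
    refine ⟨⟨by omega, ?_⟩, ?_⟩
    · rw [List.take_append_of_le_length (by omega), List.take_append_of_le_length (by omega)]
      exact hg.1.2
    · rintro i ⟨_, hi⟩
      by_contra hc
      push Not at hc
      have hk : min i r.n ∈ {i : ℕ | i ≤ r.n ∧ ρ.take i = ψ.take i} := by
        refine ⟨min_le_right _ _, ?_⟩
        have := congrArg (List.take r.n) hi
        rw [List.take_take, List.take_take, List.take_append_of_le_length (by omega),
          List.take_append_of_le_length (by omega), min_comm] at this
        exact this
      have := hg.2 hk
      omega
  have e2 := q.inter_eq _ _ (pad ρ hρ) (pad ψ hψ) _ hg'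
  rw [List.take_append_of_le_length (by omega), hσρ] at e2
  apply Finset.Subset.antisymm
  · rw [← e1, ← hs ρ hρ, ← hs ψ hψ]
    have a1 := (sub ρ hρ).2
    have a2 := (sub ψ hψ).2
    rw [← hg.1.2, hσρ] at a2
    rw [hσρ] at a1
    exact Finset.subset_inter a1 a2
  · rw [← e1, ← hs ρ hρ, ← hs ψ hψ, ← e2]
    exact Finset.inter_subset_inter (sub ρ hρ).1 (sub ψ hψ).1

instance : Preorder (QPoset h) where
  le := QPoset.le
  le_refl r := ⟨le_rfl, Finset.Subset.refl _, fun _ _ => rfl⟩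
  le_trans q r t hqr hrt := by
    refine ⟨hrt.1.trans hqr.1, hrt.2.1.trans hqr.2.1, fun ρ hρ => ?_⟩
    rw [s_eq_of_le hqr ρ (hρ.le.trans hrt.1), hrt.2.2 ρ hρ]

end QPoset

/-! ## Names and the forcing relation -/

universe u

/-- `P`-names: a name is a (small) set of pairs (name, condition). -/
inductive PName (P : Type u) : Type (u + 1)
  | mk (ι : Type u) (x : ι → PName P) (c : ι → P) : PName P

/-- Formulas of the forcing language (set theory with the names as constants). A quantified formula
is given by its instances at all names. -/
inductive Formula (P : Type u) : Type (u + 1)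
  | mem (x y : PName P) : Formula P
  | eq (x y : PName P) : Formula P
  | neg (φ : Formula P) : Formula P
  | and (φ ψ : Formula P) : Formula P
  | all (φ : PName P → Formula P) : Formula P

namespace PName

variable {P : Type u} [Preorder P]

/-- `p ⊩ x = y`: below `p`, every member of `x` is densely equal to a member of `y` and conversely. -/
def ForcesEq : PName P → PName P → P → Prop
  | mk ι x c, mk κ y d => fun p =>
    (∀ i : ι, ∀ q, q ≤ p → q ≤ c i → ∃ r, r ≤ q ∧ ∃ j : κ, r ≤ d j ∧ ForcesEq (x i) (y j) r) ∧
    (∀ j : κ, ∀ q, q ≤ p → q ≤ d j → ∃ r, r ≤ q ∧ ∃ i : ι, r ≤ c i ∧ ForcesEq (x i) (y j) r)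

/-- `p ⊩ x ∈ y`: it is dense below `p` that `x` equals some member of `y`. -/
def ForcesMem (x : PName P) : PName P → P → Prop
  | mk κ y d => fun p => ∀ q, q ≤ p → ∃ r, r ≤ q ∧ ∃ j : κ, r ≤ d j ∧ ForcesEq x (y j) r

end PName

/-- The forcing relation `p ⊩ φ`. -/
def Forces {P : Type u} [Preorder P] (p : P) : Formula P → Prop
  | .mem x y => PName.ForcesMem x y p
  | .eq x y => PName.ForcesEq x y p
  | .neg φ => ∀ q, q ≤ p → ¬ Forces q φ
  | .and φ ψ => Forces p φ ∧ Forces p ψ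
  | .all φ => ∀ x : PName P, Forces p (φ x)

/-! ### Canonical names -/

namespace PName

variable {P : Type u}

/-- The name for the set whose members are (the values of) the names `x i`. -/
def ofFamily {ι : Type u} (x : ι → PName P) : PName P :=
  mk (ι × P) (fun t => x t.1) (fun t => t.2)

/-- The name for the unordered pair `{x, y}`. -/
def upair (x y : PName P) : PName P :=
  ofFamily (ι := ULift.{u} Bool) fun b => if b.down then x else y

/-- The name for the ordered pair `(x, y) = {{x}, {x, y}}`. -/
def opair (x y : PName P) : PName P :=
  upair (upair x x) (upair x y)

end PName

/-- The canonical name for the von Neumann ordinal `{b : b < a}` of an element `a` of a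
well-ordered type. -/
noncomputable def checkElem (P : Type) {W : Type} [LinearOrder W] [WellFoundedLT W] :
    W → PName P :=
  (wellFounded_lt (α := W)).fix fun a rec =>
    PName.ofFamily fun b : {b : W // b < a} => rec b.1 b.2

theorem checkElem_eq (P : Type) {W : Type} [LinearOrder W] [WellFoundedLT W] (a : W) :
    checkElem P a = PName.ofFamily fun b : {b : W // b < a} => checkElem P b.1 :=
  (wellFounded_lt (α := W)).fix_eq _ a

/-- The canonical name for the ordinal that is the order type of `W`. -/
noncomputable def checkOrd (P : Type) (W : Type) [LinearOrder W] [WellFoundedLT W] : PName P :=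
  PName.ofFamily fun a : W => checkElem P a

/-- The canonical name for the sequence `⟨h α : α < ω₁⟩`, as the set of all `(α, (n, k))` such that
`h α` takes the value `k` at `n`. -/
noncomputable def checkSeq (P : Type) (h : Omega1 → (ℕ →. ℕ)) : PName P :=
  PName.ofFamily fun t : {t : Omega1 × ℕ × ℕ // t.2.2 ∈ h t.1 t.2.1} =>
    PName.opair (checkElem P t.1.1) (PName.opair (checkElem P t.1.2.1) (checkElem P t.1.2.2))

/-! ### Set-theoretic formulas -/

namespace Formula

variable {P : Type u}

/-- Disjunction. -/
def or (φ ψ : Formula P) : Formula P := neg (and (neg φ) (neg ψ))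

/-- Implication. -/
def imp (φ ψ : Formula P) : Formula P := neg (and φ (neg ψ))

/-- Existential quantifier. -/
def ex (φ : PName P → Formula P) : Formula P := neg (all fun x => neg (φ x))

/-- `∀ x ∈ y, φ x` -/
def allIn (y : PName P) (φ : PName P → Formula P) : Formula P := all fun x => imp (mem x y) (φ x)

/-- `∃ x ∈ y, φ x` -/
def exIn (y : PName P) (φ : PName P → Formula P) : Formula P := ex fun x => and (mem x y) (φ x)

/-- `x ⊆ y` -/
def subset (x y : PName P) : Formula P := allIn x fun z => mem z y

/-- The binary relation `R` is single-valued: `∀ x y z, R x y ∧ R x z → y = z`. -/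
def singleValued (R : PName P → PName P → Formula P) : Formula P :=
  all fun x => all fun y => all fun z => imp (and (R x y) (R x z)) (eq y z)

/-- The relation `f` maps a part of `k` onto a superset of the class `X`: it is single-valued and
each `y` in `X` is the value of `f` at some `i ∈ k`. -/
def coveredBy (f k : PName P) (X : PName P → Formula P) : Formula P :=
  and (singleValued fun i y => mem (PName.opair i y) f)
    (all fun y => imp (X y) (exIn k fun i => mem (PName.opair i y) f))

/-- `X` is countable, where `w` is a name for `ω`. -/
def countable (w : PName P) (X : PName P → Formula P) : Formula P :=
  ex fun f => coveredBy f w X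

/-- `X` is finite, where `w` is a name for `ω`: it is covered by the values of a function on
some `k ∈ ω`. -/
def finite (w : PName P) (X : PName P → Formula P) : Formula P :=
  exIn w fun k => ex fun f => coveredBy f k X

/-- `A` is an almost disjoint family of infinite subsets of `ω`. -/
def almostDisjointFamily (w A : PName P) : Formula P :=
  and (allIn A fun a => and (subset a w) (neg (finite w fun n => mem n a)))
    (allIn A fun a => allIn A fun b =>
      imp (neg (eq a b)) (finite w fun n => and (mem n a) (mem n b)))

/-- `(n, k)` belongs to `(h α ↾ a) ∪ (h β ↾ a)`, where `H` is a name for the sequence `h`. -/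
def inUnionRestrict (H α β a n k : PName P) : Formula P :=
  and (mem n a) (or (mem (PName.opair α (PName.opair n k)) H)
    (mem (PName.opair β (PName.opair n k)) H))

/-- `{h α ↾ a : α ∈ Γ}` is Luzin incoherent: for all `α < β` in `Γ`, the union
`(h α ↾ a) ∪ (h β ↾ a)` is not a function. -/
def luzinIncoherent (H Γ a : PName P) : Formula P :=
  allIn Γ fun α => allIn Γ fun β => imp (mem α β)
    (neg (singleValued fun n k => inUnionRestrict H α β a n k))

end Formula

/-- The formula: there are an uncountable `Γ ⊆ ω₁` and an uncountable almost disjoint family `A` of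
infinite subsets of `ω` such that `{h α ↾ a : α ∈ Γ}` is Luzin incoherent for each `a ∈ A`. -/
noncomputable def existsLuzinRestrictions (P : Type) (h : Omega1 → (ℕ →. ℕ)) : Formula P :=
  let w : PName P := checkOrd P ℕ
  .ex fun Γ => .ex fun A =>
    .and (.and (.subset Γ (checkOrd P Omega1)) (.neg (.countable w fun α => .mem α Γ)))
      (.and (.and (.almostDisjointFamily w A) (.neg (.countable w fun a => .mem a A)))
        (.allIn A fun a => .luzinIncoherent (checkSeq P h) Γ a))

/-! The chain condition rests on the gap lemma `exists_le_encard_ne`. Suppose that any two members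
of an uncountable family of finite modifications of the functions differ at fewer than `N` points.
Pick two members with the largest number of differences, among those all of whose initial segments
recur uncountably often. Everything sharing a long initial segment with the first agrees, beyond
that segment, with everything sharing one with the second. Gluing the common values gives a total
function coherent with the family, a contradiction.

In an uncountable antichain, pass to conditions with the same finite tree of sets and with the sets
`Γ` thinned around a root `R`. Give each condition the partial function where all `h α`, `α ∈ Γ \
R`, agree; modulo finite this contains the `h α` of least index. The gap lemma yields two conditions
whose partial functions differ at `2 ^ (n + 1)` points. One further tree level, with one such point
at each top node, separates every new pair of indices, so the two conditions are compatible
(`QPoset.isCCC`).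

For the forcing statement, take the union of all `Γ` in the generic filter, and along each ground
model branch the union of the sets `s`. Density makes the branch sets infinite. Distinct branches
meet in the finite set at their splitting node, and Luzin incoherence is built into the conditions.
Uncountability uses the chain condition twice: a name for a countable set captures only countably
many ground model objects (`IsCCC.countable_of_forces_coveredBy`), and below some condition
uncountably many indices remain possible for ever (`IsCCC.exists_forall_le_not_countable`). The
latter is why only some `q` is claimed to force the conclusion. -/

namespace PName

/-! ### Forced equality and membership, unordered and ordered pairs. -/

variable {P : Type u} [Preorder P]

theorem ForcesEq.mono {x y : PName P} {p q : P} (h : ForcesEq x y p) (hq : q ≤ p) :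
    ForcesEq x y q := by
  cases x; cases y
  exact ⟨fun i r hr => h.1 i r (hr.trans hq), fun j r hr => h.2 j r (hr.trans hq)⟩

theorem ForcesEq.refl (x : PName P) (p : P) : ForcesEq x x p := by
  induction x generalizing p with
  | mk ι x c ih =>
    exact ⟨fun i q _ hc => ⟨q, le_rfl, i, hc, ih i q⟩, fun i q _ hc => ⟨q, le_rfl, i, hc, ih i q⟩⟩

theorem ForcesEq.symm {x y : PName P} {p : P} (h : ForcesEq x y p) : ForcesEq y x p := by
  induction x generalizing y p with
  | mk ι x c ih =>
    cases y
    refine ⟨fun j q hq hd => ?_, fun i q hq hc => ?_⟩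
    · obtain ⟨r, hr, i, hi, e⟩ := h.2 j q hq hd
      exact ⟨r, hr, i, hi, ih i e⟩
    · obtain ⟨r, hr, j, hj, e⟩ := h.1 i q hq hc
      exact ⟨r, hr, j, hj, ih i e⟩

theorem ForcesEq.trans {x y z : PName P} {p : P} (h₁ : ForcesEq x y p) (h₂ : ForcesEq y z p) :
    ForcesEq x z p := by
  induction x generalizing y z p with
  | mk ι x c ih =>
    cases y; cases z
    refine ⟨fun i q hq hc => ?_, fun k q hq he => ?_⟩
    · obtain ⟨r, hr, j, hj, e⟩ := h₁.1 i q hq hc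
      obtain ⟨r', hr', k, hk, e'⟩ := h₂.1 j r (hr.trans hq) hj
      exact ⟨r', hr'.trans hr, k, hk, ih i (e.mono hr') e'⟩
    · obtain ⟨r, hr, j, hj, e⟩ := h₂.2 k q hq he
      obtain ⟨r', hr', i, hi, e'⟩ := h₁.2 j r (hr.trans hq) hj
      exact ⟨r', hr'.trans hr, i, hi, ih i e' (e.mono hr')⟩

theorem ForcesEq.of_dense {x y : PName P} {p : P}
    (h : ∀ q ≤ p, ∃ r ≤ q, ForcesEq x y r) : ForcesEq x y p := by
  cases x; cases y
  refine ⟨fun i q hq hc => ?_, fun j q hq hd => ?_⟩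
  · obtain ⟨r, hr, e⟩ := h q hq
    obtain ⟨r', hr', j, hj, e'⟩ := e.1 i r le_rfl (hr.trans hc)
    exact ⟨r', hr'.trans hr, j, hj, e'⟩
  · obtain ⟨r, hr, e⟩ := h q hq
    obtain ⟨r', hr', j, hj, e'⟩ := e.2 j r le_rfl (hr.trans hd)
    exact ⟨r', hr'.trans hr, j, hj, e'⟩

theorem ForcesMem.mono {x y : PName P} {p q : P} (h : ForcesMem x y p) (hq : q ≤ p) :
    ForcesMem x y q := by
  cases y
  exact fun r hr => h r (hr.trans hq)

theorem ForcesMem.of_dense {x y : PName P} {p : P}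
    (h : ∀ q ≤ p, ∃ r ≤ q, ForcesMem x y r) : ForcesMem x y p := by
  cases y
  intro q hq
  obtain ⟨r, hr, e⟩ := h q hq
  obtain ⟨r', hr', e'⟩ := e r le_rfl
  exact ⟨r', hr'.trans hr, e'⟩

theorem ForcesMem.congr_left {x x' y : PName P} {p : P} (h : ForcesMem x y p)
    (e : ForcesEq x x' p) : ForcesMem x' y p := by
  cases y
  intro q hq
  obtain ⟨r, hr, j, hj, e'⟩ := h q hq
  exact ⟨r, hr, j, hj, (e.mono (hr.trans hq)).symm.trans e'⟩

theorem ForcesMem.congr_right {x y y' : PName P} {p : P} (h : ForcesMem x y p)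
    (e : ForcesEq y y' p) : ForcesMem x y' p := by
  cases y; cases y'
  intro q hq
  obtain ⟨r, hr, j, hj, e'⟩ := h q hq
  obtain ⟨r', hr', k, hk, e''⟩ := e.1 j r (hr.trans hq) hj
  exact ⟨r', hr'.trans hr, k, hk, (e'.mono hr').trans e''⟩

theorem forcesMem_mk {ι : Type u} (x : ι → PName P) (c : ι → P) (i : ι) {p : P} (h : p ≤ c i) :
    ForcesMem (x i) (mk ι x c) p :=
  fun q hq => ⟨q, le_rfl, i, hq.trans h, ForcesEq.refl _ _⟩

theorem ForcesEq.of_mem {x y : PName P} {p : P}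
    (h₁ : ∀ z, ∀ q ≤ p, ForcesMem z x q → ForcesMem z y q)
    (h₂ : ∀ z, ∀ q ≤ p, ForcesMem z y q → ForcesMem z x q) : ForcesEq x y p := by
  cases x with
  | mk ι x c =>
    cases y with
    | mk κ y d =>
      refine ⟨fun i q hq hc => h₁ _ q hq (forcesMem_mk x c i hc) q le_rfl, fun j q hq hd => ?_⟩
      obtain ⟨r, hr, i, hi, e⟩ := h₂ _ q hq (forcesMem_mk y d j hd) q le_rfl
      exact ⟨r, hr, i, hi, e.symm⟩

/-- The order need not have a greatest element; since `ofFamily` attaches each entry to every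
condition, the extension `r` itself can serve as the label. -/
theorem forcesMem_ofFamily {ι : Type u} {x : ι → PName P} {z : PName P} {p : P} :
    ForcesMem z (ofFamily x) p ↔ ∀ q ≤ p, ∃ r ≤ q, ∃ i, ForcesEq z (x i) r := by
  refine forall_congr' fun q => forall_congr' fun _ => ⟨?_, ?_⟩
  · rintro ⟨r, hr, i, _, e⟩
    exact ⟨r, hr, i.1, e⟩
  · rintro ⟨r, hr, i, e⟩
    exact ⟨r, hr, (i, r), le_rfl, e⟩

theorem forcesMem_ofFamily_self {ι : Type u} (x : ι → PName P) (i : ι) (p : P) :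
    ForcesMem (x i) (ofFamily x) p :=
  forcesMem_ofFamily.2 fun q _ => ⟨q, le_rfl, i, ForcesEq.refl _ _⟩

theorem forcesMem_upair {x y z : PName P} {p : P} :
    ForcesMem z (upair x y) p ↔ ∀ q ≤ p, ∃ r ≤ q, ForcesEq z x r ∨ ForcesEq z y r := by
  unfold upair
  rw [forcesMem_ofFamily]
  refine forall_congr' fun q => forall_congr' fun _ => exists_congr fun r =>
    and_congr_right fun _ => ⟨?_, ?_⟩
  · rintro ⟨⟨_ | _⟩, e⟩
    · exact .inr e
    · exact .inl e
  · rintro (e | e)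
    · exact ⟨⟨true⟩, e⟩
    · exact ⟨⟨false⟩, e⟩

theorem forcesMem_upair_left (x y : PName P) (p : P) : ForcesMem x (upair x y) p :=
  forcesMem_upair.2 fun q _ => ⟨q, le_rfl, .inl (ForcesEq.refl _ _)⟩

theorem forcesMem_upair_right (x y : PName P) (p : P) : ForcesMem y (upair x y) p :=
  forcesMem_upair.2 fun q _ => ⟨q, le_rfl, .inr (ForcesEq.refl _ _)⟩

theorem forcesMem_singleton {x z : PName P} {p : P} :
    ForcesMem z (upair x x) p ↔ ForcesEq z x p := by
  rw [forcesMem_upair]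
  simp only [or_self]
  exact ⟨ForcesEq.of_dense, fun h q hq => ⟨q, le_rfl, h.mono hq⟩⟩

theorem ForcesEq.upair {x x' y y' : PName P} {p : P} (hx : ForcesEq x x' p)
    (hy : ForcesEq y y' p) : ForcesEq (upair x y) (upair x' y') p := by
  refine ForcesEq.of_mem ?_ ?_ <;> intro z q hq hz <;> rw [forcesMem_upair] at hz ⊢ <;>
    intro q' hq' <;> obtain ⟨r, hr, h⟩ := hz q' hq' <;> have hrp := hr.trans (hq'.trans hq)
  · exact ⟨r, hr, h.imp (·.trans (hx.mono hrp)) (·.trans (hy.mono hrp))⟩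
  · exact ⟨r, hr, h.imp (·.trans (hx.mono hrp).symm) (·.trans (hy.mono hrp).symm)⟩

theorem ForcesEq.opair {x x' y y' : PName P} {p : P} (hx : ForcesEq x x' p)
    (hy : ForcesEq y y' p) : ForcesEq (opair x y) (opair x' y') p :=
  (hx.upair hx).upair (hx.upair hy)

theorem ForcesEq.opair_fst {x x' y y' : PName P} {p : P}
    (h : ForcesEq (PName.opair x y) (PName.opair x' y') p) : ForcesEq x x' p := by
  refine ForcesEq.of_dense fun q hq => ?_
  have h1 := ((forcesMem_upair_left (PName.upair x x) (PName.upair x y) q).congr_right (h.mono hq))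
  obtain ⟨r, hr, e⟩ := forcesMem_upair.1 h1 q le_rfl
  refine ⟨r, hr, ?_⟩
  rcases e with e | e
  · exact (forcesMem_singleton.1 ((forcesMem_upair_left x' x' r).congr_right e.symm)).symm
  · exact (forcesMem_singleton.1 ((forcesMem_upair_left x' y' r).congr_right e.symm)).symm

theorem ForcesEq.opair_snd_dense {x x' y y' : PName P} {p : P}
    (h : ForcesEq (PName.opair x y) (PName.opair x' y') p) :
    ∃ r ≤ p, ForcesEq y x' r ∨ ForcesEq y y' r := by
  have h1 := ((forcesMem_upair_right (PName.upair x x) (PName.upair x y) p).congr_right h)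
  obtain ⟨r, hr, e⟩ := forcesMem_upair.1 h1 p le_rfl
  rcases e with e | e
  · exact ⟨r, hr, .inl (forcesMem_singleton.1 ((forcesMem_upair_right x y r).congr_right e))⟩
  · obtain ⟨r', hr', e'⟩ :=
      forcesMem_upair.1 ((forcesMem_upair_right x y r).congr_right e) r le_rfl
    exact ⟨r', hr'.trans hr, e'⟩

theorem ForcesEq.opair_snd {x x' y y' : PName P} {p : P}
    (h : ForcesEq (PName.opair x y) (PName.opair x' y') p) : ForcesEq y y' p := by
  refine ForcesEq.of_dense fun q hq => ?_
  obtain ⟨r, hr, e⟩ := (h.mono hq).opair_snd_dense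
  obtain ⟨r', hr', e'⟩ := (h.mono (hr.trans hq)).symm.opair_snd_dense
  refine ⟨r', hr'.trans hr, ?_⟩
  rcases e with e | e
  · rcases e' with e' | e'
    -- The crossed case: `y = x'` and `y' = x`, closed by the equality `x = x'` of first
    -- coordinates.
    · exact (e.mono hr').trans ((h.opair_fst.mono (hr'.trans (hr.trans hq))).symm.trans e'.symm)
    · exact e'.symm
  · exact e.mono hr'

end PName

open PName

/-! ### Canonical names of elements of a well-order. -/

section Check

variable {P W : Type} [Preorder P] [LinearOrder W] [WellFoundedLT W]

theorem forcesMem_checkElem {a : W} {z : PName P} {p : P} :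
    ForcesMem z (checkElem P a) p ↔ ∀ q ≤ p, ∃ r ≤ q, ∃ b < a, ForcesEq z (checkElem P b) r := by
  rw [checkElem_eq, forcesMem_ofFamily]
  simp

theorem forcesMem_checkElem_of_lt {a b : W} (h : b < a) (p : P) :
    ForcesMem (checkElem P b) (checkElem P a) p :=
  forcesMem_checkElem.2 fun q _ => ⟨q, le_rfl, b, h, ForcesEq.refl _ _⟩

/-- Well-foundedness: membership of `a` in itself would make `a` equal to some `b < a`, which then
belongs to itself. It follows that canonical names of distinct elements are never forced equal. -/
theorem not_forcesMem_checkElem_self (a : W) (p : P) :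
    ¬ ForcesMem (checkElem P a) (checkElem P a) p := by
  induction a using WellFoundedLT.induction generalizing p with
  | ind a ih =>
    intro h
    obtain ⟨r, hr, b, hb, e⟩ := forcesMem_checkElem.1 h p le_rfl
    exact ih b hb r (((forcesMem_checkElem_of_lt hb r).congr_right e))

theorem checkElem_injective {a b : W} {p : P} (h : ForcesEq (checkElem P a) (checkElem P b) p) :
    a = b := by
  rcases lt_trichotomy a b with hab | rfl | hab
  · exact absurd ((forcesMem_checkElem_of_lt hab p).congr_right h.symm)
      (not_forcesMem_checkElem_self _ _)
  · rfl
  · exact absurd ((forcesMem_checkElem_of_lt hab p).congr_right h)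
      (not_forcesMem_checkElem_self _ _)

end Check

/-! ### Forcing clauses for the derived connectives. -/

section Forces

variable {P : Type u} [Preorder P]

theorem Forces.mono {φ : Formula P} {p q : P} (h : Forces p φ) (hq : q ≤ p) : Forces q φ := by
  induction φ with
  | mem x y => exact ForcesMem.mono h hq
  | eq x y => exact ForcesEq.mono h hq
  | neg φ _ => exact fun r hr => h r (hr.trans hq)
  | and φ ψ ih₁ ih₂ => exact ⟨ih₁ h.1, ih₂ h.2⟩
  | all φ ih => exact fun x => ih x (h x)

/-- This allows passing to a stronger condition that decides which ground model object a given name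
denotes. -/
theorem Forces.of_dense {φ : Formula P} {p : P} (h : ∀ q ≤ p, ∃ r ≤ q, Forces r φ) :
    Forces p φ := by
  induction φ generalizing p with
  | mem x y => exact ForcesMem.of_dense h
  | eq x y => exact ForcesEq.of_dense h
  | neg φ _ =>
    intro q hq hφ
    obtain ⟨r, hr, hn⟩ := h q hq
    exact hn r le_rfl (hφ.mono hr)
  | and φ ψ ih₁ ih₂ =>
    refine ⟨ih₁ fun q hq => ?_, ih₂ fun q hq => ?_⟩ <;> obtain ⟨r, hr, hn⟩ := h q hq
    exacts [⟨r, hr, hn.1⟩, ⟨r, hr, hn.2⟩]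
  | all φ ih =>
    refine fun x => ih x fun q hq => ?_
    obtain ⟨r, hr, hn⟩ := h q hq
    exact ⟨r, hr, hn x⟩

theorem forces_imp {φ ψ : Formula P} {p : P} :
    Forces p (.imp φ ψ) ↔ ∀ q ≤ p, Forces q φ → Forces q ψ := by
  constructor
  · intro h q hq hφ
    refine Forces.of_dense fun q' hq' => ?_
    by_contra hc
    push Not at hc
    exact h q' (hq'.trans hq) ⟨hφ.mono hq', hc⟩
  · rintro h q hq ⟨h₁, h₂⟩
    exact h₂ q le_rfl (h q hq h₁)

theorem forces_ex {φ : PName P → Formula P} {p : P} :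
    Forces p (.ex φ) ↔ ∀ q ≤ p, ∃ r ≤ q, ∃ x, Forces r (φ x) := by
  constructor
  · intro h q hq
    by_contra hc
    push Not at hc
    exact h q hq fun x r hr => hc r hr x
  · intro h q hq hn
    obtain ⟨r, hr, x, hx⟩ := h q hq
    exact hn x r hr hx

theorem Forces.ex {φ : PName P → Formula P} {p : P} (x : PName P) (h : Forces p (φ x)) :
    Forces p (.ex φ) :=
  forces_ex.2 fun q hq => ⟨q, le_rfl, x, h.mono hq⟩

theorem Forces.or {φ ψ : Formula P} {p : P} (h : Forces p φ ∨ Forces p ψ) :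
    Forces p (.or φ ψ) := by
  rintro q hq ⟨h₁, h₂⟩
  exact h.elim (fun h => h₁ q le_rfl (h.mono hq)) fun h => h₂ q le_rfl (h.mono hq)

theorem forces_allIn {y : PName P} {φ : PName P → Formula P} {p : P} :
    Forces p (.allIn y φ) ↔ ∀ x, ∀ q ≤ p, ForcesMem x y q → Forces q (φ x) :=
  forall_congr' fun _ => forces_imp

theorem forces_exIn {y : PName P} {φ : PName P → Formula P} {p : P} :
    Forces p (.exIn y φ) ↔ ∀ q ≤ p, ∃ r ≤ q, ∃ x, ForcesMem x y r ∧ Forces r (φ x) :=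
  forces_ex

theorem forces_singleValued {R : PName P → PName P → Formula P} {p : P} :
    Forces p (.singleValued R) ↔
      ∀ x y z, ∀ q ≤ p, Forces q (R x y) → Forces q (R x z) → ForcesEq y z q :=
  forall_congr' fun _ => forall_congr' fun _ => forall_congr' fun _ => forces_imp.trans
    (forall_congr' fun _ => forall_congr' fun _ =>
      ⟨fun h h₁ h₂ => h ⟨h₁, h₂⟩, fun h h' => h h'.1 h'.2⟩)

theorem forces_coveredBy {f k : PName P} {X : PName P → Formula P} {p : P} :
    Forces p (.coveredBy f k X) ↔
      (∀ x y z, ∀ q ≤ p, ForcesMem (opair x y) f q → ForcesMem (opair x z) f q →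
        ForcesEq y z q) ∧
      ∀ y, ∀ q ≤ p, Forces q (X y) → ∃ r ≤ q, ∃ i, ForcesMem i k r ∧ ForcesMem (opair i y) f r := by
  refine and_congr forces_singleValued (forall_congr' fun y => forces_imp.trans
    ⟨fun h q hq hX => forces_exIn.1 (h q hq hX) q le_rfl, fun h q hq hX => forces_exIn.2 ?_⟩)
  exact fun q' hq' => h q' (hq'.trans hq) (hX.mono hq')

end Forces

/-! ### Consequences of the countable chain condition. -/

section Covering

variable {P : Type} [Preorder P]

theorem exists_forcesMem_opair_checkElem {W : Type} [LinearOrder W] [WellFoundedLT W]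
    {f i y : PName P} {p : P} {b : W} (h : ForcesMem (opair i y) f p)
    (e : ForcesEq i (checkElem P b) p) : ForcesMem (opair (checkElem P b) y) f p :=
  h.congr_left (e.opair (ForcesEq.refl _ _))

/-- Under the countable chain condition, a set that is forced to be countable contains only
countably many possible members among given names for distinct objects. -/
theorem IsCCC.countable_of_forces_coveredBy (hccc : IsCCC P) {I : Type*} (t : I → PName P)
    (ht : ∀ i j, i ≠ j → ∀ p, ¬ ForcesEq (t i) (t j) p) {f : PName P} {X : PName P → Formula P}
    {p : P} (hf : Forces p (.coveredBy f (checkOrd P ℕ) X)) :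
    {i | ∃ q ≤ p, Forces q (X (t i))}.Countable := by
  obtain ⟨hsv, hcov⟩ := forces_coveredBy.1 hf
  have key : ∀ i ∈ {i | ∃ q ≤ p, Forces q (X (t i))}, ∃ n : ℕ, ∃ r ≤ p,
      ForcesMem (opair (checkElem P n) (t i)) f r := by
    rintro i ⟨q, hq, hX⟩
    obtain ⟨r, hr, k, hk, hm⟩ := hcov _ q hq hX
    obtain ⟨r', hr', n, e⟩ := forcesMem_ofFamily.1 hk r le_rfl
    exact ⟨n, r', hr'.trans (hr.trans hq), exists_forcesMem_opair_checkElem (hm.mono hr') e⟩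
  refine (Set.countable_iUnion (t := fun n : ℕ => {i | ∃ r ≤ p,
    ForcesMem (opair (checkElem P n) (t i)) f r}) fun n => ?_).mono fun i hi =>
      Set.mem_iUnion.2 (key i hi)
  set S : Set I := {i | ∃ r ≤ p, ForcesMem (opair (checkElem P n) (t i)) f r}
  -- For a fixed argument `n`, conditions assigning different values to `f` are incompatible, as `f`
  -- is single-valued; so they form an antichain indexed by `S`.
  choose r hr hm using fun i : S => i.2
  have incomp : ∀ i j : S, i ≠ j → ¬ Compatible (r i) (r j) := by
    rintro i j hij ⟨c, hi, hj⟩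
    exact ht i j (fun h => hij (Subtype.ext h)) c
      (hsv _ _ _ c (hi.trans (hr i)) ((hm i).mono hi) ((hm j).mono hj))
  have inj : Function.Injective r := by
    intro i j hij
    by_contra hne
    exact incomp i j hne ⟨r i, le_rfl, hij.le⟩
  have hc : (Set.range r).Countable := by
    refine hccc _ ?_
    rintro _ ⟨i, rfl⟩ _ ⟨j, rfl⟩ hij
    exact incomp i j fun h => hij (congrArg r h)
  have : Countable S := by
    have := hc.to_subtype
    exact (Set.rangeFactorization_injective.2 inj).countable
  exact Set.to_countable S

/-- Under the countable chain condition, if every element of an uncountable set belongs to the label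
of some condition, then below some condition this remains so for every stronger condition. -/
theorem IsCCC.exists_forall_le_not_countable (hccc : IsCCC P) {W : Type*} (G : P → Set W)
    (hG : ∀ p q, q ≤ p → G p ⊆ G q) (hun : ¬ {a | ∃ p, a ∈ G p}.Countable) :
    ∃ q : P, ∀ p ≤ q, ¬ {a | ∃ r ≤ p, a ∈ G r}.Countable := by
  by_contra hc
  push Not at hc
  -- By the negated claim `D` is dense. A maximal antichain inside `D` is countable, and every label
  -- turns up below one of its members.
  let D : Set P := {p | {a | ∃ r ≤ p, a ∈ G r}.Countable}
  let C : Set (Set P) := {A | A ⊆ D ∧ ∀ p ∈ A, ∀ q ∈ A, p ≠ q → ¬ Compatible p q}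
  obtain ⟨A, hA⟩ := zorn_subset C fun c hcC hch => ⟨⋃₀ c,
    ⟨Set.sUnion_subset fun s hs => (hcC hs).1, by
      rintro p ⟨s, hs, hps⟩ q ⟨t, ht, hqt⟩ hpq
      rcases hch.total hs ht with h | h
      · exact (hcC ht).2 p (h hps) q hqt hpq
      · exact (hcC hs).2 p hps q (h hqt) hpq⟩, fun s hs => Set.subset_sUnion_of_mem hs⟩
  have hAc : A.Countable := hccc A hA.prop.2
  refine hun ((hAc.biUnion fun p hp => hA.prop.1 hp).mono ?_)
  rintro a ⟨p, hap⟩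
  obtain ⟨q, hqp, hq⟩ := hc p
  have : ∃ p' ∈ A, Compatible p' q := by
    by_contra hno
    push Not at hno
    have hins : insert q A ∈ C := by
      refine ⟨Set.insert_subset hq hA.prop.1, ?_⟩
      rintro x (rfl | hx) y (rfl | hy) hxy
      · exact absurd rfl hxy
      · exact fun ⟨r, h₁, h₂⟩ => hno y hy ⟨r, h₂, h₁⟩
      · exact hno x hx
      · exact hA.prop.2 x hx y hy hxy
    have hqA : q ∈ A := hA.le_of_ge hins (Set.subset_insert _ _) (Set.mem_insert _ _)
    exact hno q hqA ⟨q, le_rfl, le_rfl⟩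
  obtain ⟨p', hp', r, hr, hrq⟩ := this
  exact Set.mem_biUnion hp' ⟨r, hr, hG _ _ (hrq.trans hqp) hap⟩

end Covering

/-! ### Countability in the first uncountable ordinal. -/

section Omega1

theorem Omega1.countable_Iio (a : Omega1) : (Set.Iio a).Countable := by
  have h : Ordinal.typein (α := Omega1) (· < ·) a < (Cardinal.aleph 1).ord :=
    (Ordinal.typein_lt_self a).trans_eq (Cardinal.ord_aleph 1).symm
  rw [Cardinal.lt_ord, Ordinal.card_typein, ← Cardinal.succ_aleph0, Order.lt_succ_iff] at h
  exact Cardinal.le_aleph0_iff_set_countable.1 h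

theorem Omega1.countable_Iic (a : Omega1) : (Set.Iic a).Countable := by
  rw [← Set.Iio_insert]
  exact (Omega1.countable_Iio a).insert a

theorem Omega1.not_countable_univ : ¬ (Set.univ : Set Omega1).Countable := by
  rw [← Cardinal.le_aleph0_iff_set_countable, Cardinal.mk_univ, Cardinal.mk_toType,
    ← Cardinal.ord_aleph, Cardinal.card_ord, not_le]
  exact Cardinal.aleph0_lt_aleph_one

end Omega1

/-! ### Thinning out uncountable families. -/

section Uncountable

theorem exists_not_countable_fiber {I C : Type*} [Countable C] {S : Set I} (hS : ¬ S.Countable)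
    (f : I → C) : ∃ c, ¬ {i ∈ S | f i = c}.Countable := by
  by_contra hc
  push Not at hc
  refine hS ((Set.countable_iUnion hc).mono fun i hi => ?_)
  exact Set.mem_iUnion_of_mem (f i) ⟨hi, rfl⟩

theorem Set.nonempty_of_not_countable {I : Type*} {S : Set I} (hS : ¬ S.Countable) : S.Nonempty :=
  Set.nonempty_iff_ne_empty.2 fun h => hS (h ▸ Set.countable_empty)

theorem Set.inter_not_countable {I : Type*} {S T : Set I} (hS : ¬ S.Countable)
    (hT : Tᶜ.Countable) : ¬ (S ∩ T).Countable := fun h =>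
  hS ((h.union hT).mono fun i hi => (em (i ∈ T)).imp (fun h => ⟨hi, h⟩) id)

/-- An uncountable family of finite sets of bounded size has an uncountable subfamily with a root
outside of which each point belongs to only countably many members. -/
theorem exists_root {I W : Type*} [DecidableEq W] (G : I → Finset W) {S : Set I}
    (hS : ¬ S.Countable) (k : ℕ) (hk : ∀ i ∈ S, (G i).card ≤ k) :
    ∃ R : Finset W, ∃ T ⊆ S, ¬ T.Countable ∧ (∀ i ∈ T, R ⊆ G i) ∧
      ∀ a ∉ R, {i ∈ T | a ∈ G i}.Countable := by
  classical
  -- The root is a set of maximal size contained in uncountably many members; a further point lying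
  -- in uncountably many of these would enlarge it.
  let p : ℕ → Prop := fun n => ∃ R : Finset W, R.card = n ∧ ¬ {i ∈ S | R ⊆ G i}.Countable
  have h0 : p 0 := ⟨∅, rfl, by simpa using hS⟩
  obtain ⟨R, hR, hun⟩ := Nat.findGreatest_spec (Nat.zero_le k) h0
  refine ⟨R, {i ∈ S | R ⊆ G i}, fun i hi => hi.1, hun, fun i hi => hi.2, fun a ha => ?_⟩
  by_contra hc
  have heq : {i ∈ {i ∈ S | R ⊆ G i} | a ∈ G i} = {i ∈ S | insert a R ⊆ G i} := by
    ext i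
    simp [Finset.insert_subset_iff]
    tauto
  rw [heq] at hc
  obtain ⟨i, hi⟩ := Set.nonempty_of_not_countable hc
  have hle : (insert a R).card ≤ k := (Finset.card_le_card hi.2).trans (hk i hi.1)
  have := Nat.le_findGreatest hle (show p _ from ⟨_, rfl, hc⟩)
  rw [Finset.card_insert_of_notMem ha, hR] at this
  omega

end Uncountable

/-! ### The gap lemma: no total extension forces many disagreements. -/

section Gap

variable {h : Omega1 → (ℕ →. ℕ)}

theorem finite_setOf_mem_notMem (hcoh : Coherent (Set.range h)) (hdom : ModFiniteIncreasingDoms h)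
    {α β : Omega1} (hαβ : α ≤ β) : {k | ∃ u ∈ h α k, u ∉ h β k}.Finite := by
  rcases hαβ.eq_or_lt with rfl | hlt
  · convert Set.finite_empty
    ext k
    simp
  refine ((hdom α β hlt).union (hcoh _ ⟨α, rfl⟩ _ ⟨β, rfl⟩)).subset ?_
  rintro k ⟨u, hu, hn⟩
  by_cases hk : k ∈ (h β).Dom
  · obtain ⟨v, hv⟩ := (PFun.mem_dom _ _).1 hk
    exact .inr ⟨u, hu, v, hv, fun e => hn (e ▸ hv)⟩
  · exact .inl ⟨(PFun.mem_dom _ _).2 ⟨u, hu⟩, hk⟩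

/-- If a coherent sequence has no total extension, then in each uncountable family of finite
modifications some two members differ at arbitrarily many points. -/
theorem exists_le_encard_ne (hcoh : Coherent (Set.range h)) (hdom : ModFiniteIncreasingDoms h)
    (hext : ¬ ∃ g : ℕ → ℕ, Coherent (Set.range h ∪ {(g : ℕ →. ℕ)}))
    {I : Type*} [Uncountable I] (a : I → Omega1) (ha : ∀ δ, {i | a i ≤ δ}.Countable)
    (f : I → ℕ → Option ℕ)
    (hfin : ∀ i, {k | ∃ u ∈ h (a i) k, f i k ≠ some u}.Finite) (N : ℕ) :
    ∃ i j, (N : ℕ∞) ≤ {k | ∃ u v, f i k = some u ∧ f j k = some v ∧ u ≠ v}.encard := by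
  classical
  by_contra hlt
  push Not at hlt
  let D : I → I → Set ℕ := fun i j => {k | ∃ u v, f i k = some u ∧ f j k = some v ∧ u ≠ v}
  have hDfin : ∀ i j, (D i j).Finite := fun i j =>
    Set.finite_of_encard_le_coe (hlt i j).le
  have hDN : ∀ i j, (D i j).ncard ≤ N := fun i j => by
    have := (hlt i j).le
    rwa [← (hDfin i j).cast_ncard_eq, Nat.cast_le] at this
  let τ : ℕ → I → List (Option ℕ) := fun m i => (List.range m).map (f i)
  have hτ : ∀ {m i j}, τ m i = τ m j → ∀ k < m, f i k = f j k := fun {m i j} e k hk =>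
    List.map_inj_left.1 e k (List.mem_range.2 hk)
  -- There are only countably many finite initial segments, so all but countably many indices have
  -- every initial segment shared by uncountably many others.
  let Y : Set I := {i | ∀ m, ¬ {j | τ m j = τ m i}.Countable}
  have hY : Yᶜ.Countable := by
    refine (Set.countable_iUnion fun m : ℕ => Set.countable_iUnion fun l : List (Option ℕ) =>
      Set.countable_iUnion fun hl : {j | τ m j = l}.Countable => hl).mono fun i hi => ?_
    simp only [Y, Set.mem_compl_iff, Set.mem_ofPred_eq, not_forall, not_not] at hi
    obtain ⟨m, hm⟩ := hi
    simp only [Set.mem_iUnion]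
    exact ⟨m, τ m i, hm, rfl⟩
  have hYun := Set.inter_not_countable Set.not_countable_univ hY
  obtain ⟨i₀, -, hi₀⟩ := Set.nonempty_of_not_countable hYun
  -- The pair `ξ`, `η` maximizes the number of differences. If `i`, `j` copy it up to `m`, a bound
  -- of `D ξ η`, then `D i j` contains `D ξ η` and by maximality equals it.
  let p : ℕ → Prop := fun d => ∃ i ∈ Y, ∃ j ∈ Y, (D i j).ncard = d
  obtain ⟨ξ, hξ, η, hη, hd⟩ := Nat.findGreatest_spec (P := p) (hDN i₀ i₀) ⟨i₀, hi₀, i₀, hi₀, rfl⟩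
  obtain ⟨m, hm⟩ := (hDfin ξ η).bddAbove
  set U : Set I := {j | τ (m + 1) j = τ (m + 1) ξ} ∩ Y
  set V : Set I := {j | τ (m + 1) j = τ (m + 1) η} ∩ Y
  have hUV : ∀ i ∈ U, ∀ j ∈ V, ∀ k, m < k → ∀ u v, f i k = some u → f j k = some v → u = v := by
    intro i hi j hj k hk u v hu hv
    have hsub : D ξ η ⊆ D i j := by
      rintro l ⟨u, v, hu, hv, hne⟩
      have hl : l < m + 1 := Nat.lt_succ_of_le (hm ⟨u, v, hu, hv, hne⟩)
      exact ⟨u, v, (hτ hi.1 l hl).trans hu, (hτ hj.1 l hl).trans hv, hne⟩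
    have hle := Nat.le_findGreatest (hDN i j) (show p _ from ⟨i, hi.2, j, hj.2, rfl⟩)
    rw [← hd] at hle
    have heq := Set.eq_of_subset_of_ncard_le hsub hle (hDfin i j)
    by_contra hne
    have : k ∈ D ξ η := heq ▸ ⟨u, v, hu, hv, hne⟩
    exact absurd (hm this) (not_le.2 hk)
  have hbig : ∀ T : Set I, ¬ T.Countable → ∀ δ, ∃ i ∈ T, δ < a i := by
    intro T hT δ
    by_contra hc
    push Not at hc
    exact hT ((ha δ).mono hc)
  have hU := hbig U (Set.inter_not_countable (hξ (m + 1)) hY)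
  have hV := hbig V (Set.inter_not_countable (hη (m + 1)) hY)
  -- Only pairs across `U` and `V` are known to agree. Demanding a witness on each side makes the
  -- value unique: compare the `U`-witness of one value with the `V`-witness of the other.
  let Q : ℕ → ℕ → Prop := fun k u => ∃ i ∈ U, ∃ j ∈ V, f i k = some u ∧ f j k = some u
  have hQ : ∀ k u v, m < k → Q k u → Q k v → u = v := by
    rintro k u v hk ⟨i, hi, _, _, hu, _⟩ ⟨_, _, j, hj, _, hv⟩
    exact hUV i hi j hj k hk u v hu hv
  let g : ℕ → ℕ := fun k => if hk : ∃ u, Q k u then hk.choose else 0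
  have hg : ∀ k u, m < k → Q k u → g k = u := by
    intro k u hk hu
    have hex : ∃ u, Q k u := ⟨u, hu⟩
    simp only [g, dif_pos hex]
    exact hQ _ _ _ hk hex.choose_spec hu
  have hhg : ∀ α, {k | ∃ x ∈ h α k, x ≠ g k}.Finite := by
    intro α
    -- Uncountable sets have members with arbitrarily large index, so `h α` is contained modulo
    -- finite in some `f i` with `i ∈ U` and in some `f j` with `j ∈ V`.
    obtain ⟨i, hi, hαi⟩ := hU α
    obtain ⟨j, hj, hij⟩ := hV (a i)
    refine (((Set.finite_Iic m).union (finite_setOf_mem_notMem hcoh hdom hαi.le)).union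
      ((hfin i).union ((finite_setOf_mem_notMem hcoh hdom hij.le).union (hfin j)))).subset ?_
    rintro k ⟨x, hx, hne⟩
    by_contra hc
    simp only [Set.mem_union, Set.mem_Iic, Set.mem_ofPred_eq, not_or, not_exists, not_and,
      not_not, not_le] at hc
    obtain ⟨⟨h1, h2⟩, h3, h4, h5⟩ := hc
    have hxi := h2 x hx
    exact hne (hg k x h1 ⟨i, hi, j, hj, h3 x hxi, h5 x (h4 x hxi)⟩).symm
  refine hext ⟨g, ?_⟩
  rintro p (hp | rfl) q (hq | rfl)
  · exact hcoh p hp q hq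
  · obtain ⟨α, rfl⟩ := hp
    refine (hhg α).subset ?_
    rintro k ⟨x, hx, y, hy, hne⟩
    obtain rfl : y = g k := by simpa using hy
    exact ⟨x, hx, hne⟩
  · obtain ⟨α, rfl⟩ := hq
    refine (hhg α).subset ?_
    rintro k ⟨x, hx, y, hy, hne⟩
    obtain rfl : x = g k := by simpa using hx
    exact ⟨y, hy, hne.symm⟩
  · convert Set.finite_empty
    ext k
    simp

end Gap

/-! ### Extending conditions and the countable chain condition. -/

theorem IsFunctionGraph.mono {R S : Set (ℕ × ℕ)} (hS : IsFunctionGraph S) (hRS : R ⊆ S) :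
    IsFunctionGraph R :=
  fun n x y hx hy => hS n x y (hRS hx) (hRS hy)

theorem unionRestrict_mono {f g : ℕ →. ℕ} {s t : Set ℕ} (hst : s ⊆ t) :
    unionRestrict f g s ⊆ unionRestrict f g t :=
  fun _ hz => ⟨hst hz.1, hz.2⟩

namespace QPoset

variable {h : Omega1 → (ℕ →. ℕ)}

/-- A condition may be extended by one level, adding one new point to each of the top sets. -/
theorem exists_extension (r : QPoset h) (e : List Bool → ℕ) (Γ' : Finset Omega1) (hΓ : r.Γ ⊆ Γ')
    (hinj : Set.InjOn e {ρ | ρ.length = r.n + 1})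
    (hnew : ∀ ρ : List Bool, ρ.length = r.n + 1 → ∀ σ, e ρ ∉ r.s σ)
    (hΓ' : ∀ α ∈ Γ', ∀ β ∈ Γ', α ≠ β → ∀ ρ : List Bool, ρ.length = r.n + 1 →
      ¬ IsFunctionGraph (unionRestrict (h α) (h β)
        (insert (e ρ) (r.s (ρ.take r.n)) : Finset ℕ))) :
    ∃ q ≤ r, q.n = r.n + 1 ∧ q.Γ = Γ' ∧ (∀ ρ : List Bool, ρ.length ≤ r.n → q.s ρ = r.s ρ) ∧
      ∀ ρ : List Bool, ρ.length = r.n + 1 → q.s ρ = insert (e ρ) (r.s (ρ.take r.n)) := by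
  classical
  let s : List Bool → Finset ℕ := fun ρ =>
    if ρ.length = r.n + 1 then insert (e ρ) (r.s (ρ.take r.n)) else r.s ρ
  have hs1 : ∀ ρ : List Bool, ρ.length = r.n + 1 → s ρ = insert (e ρ) (r.s (ρ.take r.n)) :=
    fun ρ hρ => if_pos hρ
  have hs2 : ∀ ρ : List Bool, ρ.length ≤ r.n → s ρ = r.s ρ :=
    fun ρ hρ => if_neg (by omega)
  have htake : ∀ ρ : List Bool, ∀ j ≤ r.n, s (ρ.take j) = r.s ((ρ.take r.n).take j) := by
    intro ρ j hj
    rw [List.take_take, min_eq_left hj, hs2 _ ((List.length_take_le _ _).trans hj)]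
  let q : QPoset h :=
    { n := r.n + 1
      s := s
      Γ := Γ'
      s_out := fun ρ hρ => by
        rw [show s ρ = r.s ρ from if_neg (by omega)]
        exact r.s_out ρ (by omega)
      not_function := fun α hα β hβ hne ρ hρ => by
        rw [hs1 ρ hρ]
        exact hΓ' α hα β hβ hne ρ hρ
      increasing := fun ρ hρ j k hjk hk => by
        have hlen : (ρ.take r.n).length = r.n := by simp [hρ]
        rcases hk.eq_or_lt with rfl | hk
        · rw [List.take_of_length_le hρ.le]
          rcases hjk.eq_or_lt with rfl | hj
          · rw [List.take_of_length_le hρ.le]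
          · rw [htake ρ j (by omega), hs1 ρ hρ]
            have := r.increasing _ hlen j r.n (by omega) le_rfl
            rw [List.take_of_length_le hlen.le] at this
            exact this.trans (Finset.subset_insert _ _)
        · rw [htake ρ j (by omega), htake ρ k (by omega)]
          exact r.increasing _ hlen j k hjk (by omega)
      inter_eq := fun ρ ψ hρ hψ j hj => by
        have hρn : (ρ.take r.n).length = r.n := by simp [hρ]
        have hψn : (ψ.take r.n).length = r.n := by simp [hψ]
        by_cases heq : ρ = ψ
        · subst heq
          have : j = r.n + 1 := le_antisymm hj.1.1 (hj.2 ⟨le_rfl, rfl⟩)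
          rw [this, List.take_of_length_le hρ.le, Finset.inter_self]
        · have hjn : j ≤ r.n := by
            by_contra hc
            have := hj.1.2
            rw [List.take_of_length_le (by omega), List.take_of_length_le (by omega)] at this
            exact heq this
          have hg : IsGreatest {i : ℕ | i ≤ r.n ∧ (ρ.take r.n).take i = (ψ.take r.n).take i} j := by
            refine ⟨⟨hjn, ?_⟩, ?_⟩
            · rw [List.take_take, List.take_take, min_eq_left hjn]
              exact hj.1.2
            · rintro i ⟨hi, hi'⟩
              rw [List.take_take, List.take_take, min_eq_left hi] at hi'
              exact hj.2 ⟨by omega, hi'⟩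
          -- The added points are distinct and outside all old sets, so they do not affect
          -- intersections.
          have hne : e ρ ≠ e ψ := fun h => heq (hinj hρ hψ h)
          rw [htake ρ j hjn, ← r.inter_eq _ _ hρn hψn j hg, hs1 ρ hρ, hs1 ψ hψ,
            Finset.insert_inter_of_notMem, Finset.inter_insert_of_notMem]
          · exact hnew ψ hψ _
          · simpa [hne] using hnew ρ hρ _ }
  exact ⟨q, ⟨by simp [q], hΓ, fun ρ hρ => hs2 ρ hρ.le⟩, rfl, rfl, hs2, hs1⟩

theorem exists_bound (r : QPoset h) : ∃ m, ∀ σ, ∀ k ∈ r.s σ, k < m := by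
  obtain ⟨m, hm⟩ := ((List.finite_length_le Bool r.n).biUnion
    fun σ _ => (r.s σ).finite_toSet).bddAbove
  refine ⟨m + 1, fun σ k hk => Nat.lt_succ_of_le (hm ?_)⟩
  refine Set.mem_biUnion (x := σ) ?_ hk
  by_contra hc
  rw [r.s_out σ (by simpa using hc)] at hk
  simp at hk

theorem exists_injOn_length {n : ℕ} {D : Set ℕ} (hD : ((2 ^ n : ℕ) : ℕ∞) ≤ D.encard) :
    ∃ e : List Bool → ℕ, (∀ ρ : List Bool, ρ.length = n → e ρ ∈ D) ∧
      Set.InjOn e {ρ | ρ.length = n} := by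
  have hcard : {ρ : List Bool | ρ.length = n}.encard = ((2 ^ n : ℕ) : ℕ∞) := by
    change ENat.card (List.Vector Bool n) = _
    rw [ENat.card_eq_coe_fintype_card, card_vector, Fintype.card_bool]
  obtain ⟨e, he, hinj⟩ := (List.finite_length_eq Bool n).exists_injOn_of_encard_le
    (hcard.trans_le hD)
  exact ⟨e, fun ρ hρ => he hρ, hinj⟩

theorem isCCC (hcoh : Coherent (Set.range h)) (hdom : ModFiniteIncreasingDoms h)
    (hext : ¬ ∃ g : ℕ → ℕ, Coherent (Set.range h ∪ {(g : ℕ →. ℕ)})) : IsCCC (QPoset h) := by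
  classical
  intro A hA
  by_contra hun
  -- Countably many codes: uncountably many conditions share the whole tree `s` and the size of `Γ`.
  let code : QPoset h → ℕ × ℕ × List (Finset ℕ) := fun q =>
    (q.n, q.Γ.card, (List.finite_length_le Bool q.n).toFinset.toList.map q.s)
  obtain ⟨⟨n, k, l⟩, hS⟩ := exists_not_countable_fiber hun code
  set S := {q ∈ A | code q = (n, k, l)}
  have hSn : ∀ q ∈ S, q.n = n := fun q hq => congrArg Prod.fst hq.2
  have hSk : ∀ q ∈ S, q.Γ.card = k := fun q hq => congrArg (·.2.1) hq.2
  have hSs : ∀ q ∈ S, ∀ r ∈ S, q.s = r.s := by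
    intro q hq r hr
    have hc : code q = code r := hq.2.trans hr.2.symm
    have hn : q.n = r.n := (hSn q hq).trans (hSn r hr).symm
    have h2 : _ = _ := congrArg (·.2.2) hc
    simp only [code, hn] at h2
    funext σ
    by_cases hσ : σ.length ≤ r.n
    · exact List.map_inj_left.1 h2 σ (by simpa using hσ)
    · rw [q.s_out σ (by omega), r.s_out σ (by omega)]
  obtain ⟨R, T, hTS, hT, hR, hroot⟩ := exists_root QPoset.Γ hS k fun q hq => (hSk q hq).le
  obtain ⟨q₀, hq₀⟩ := Set.nonempty_of_not_countable hT
  -- If some `Γ` were just `R`, equality of sizes would make all of `T` a single condition.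
  have hne : ∀ q ∈ T, (q.Γ \ R).Nonempty := by
    intro q hq
    rw [Finset.nonempty_iff_ne_empty]
    intro hemp
    have hqR : q.Γ = R := (Finset.sdiff_eq_empty_iff_subset.1 hemp).antisymm (hR q hq)
    refine hT ((Set.countable_singleton q).mono fun r hr => ?_)
    have hrR : R = r.Γ := Finset.eq_of_subset_of_card_le (hR r hr)
      (by rw [hSk r (hTS hr), ← hSk q (hTS hq), hqR])
    exact QPoset.ext ((hSn r (hTS hr)).trans (hSn q (hTS hq)).symm) (hSs r (hTS hr) q (hTS hq))
      (hrR.symm.trans hqR.symm)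
  have : Uncountable T := by
    rw [← not_countable_iff]
    exact fun h => hT (Set.to_countable T)
  obtain ⟨m, hm⟩ := q₀.exists_bound
  -- The partial function takes the common value of all `h α` with `α ∈ Γ \ R`. Cutting it off below
  -- `m` keeps every point of disagreement outside the shared sets `s`.
  have hfex : ∀ (i : T) (k : ℕ), ∃ o : Option ℕ, ∀ u, o = some u ↔
      m ≤ k ∧ ∀ α ∈ i.1.Γ \ R, u ∈ h α k := by
    intro i k
    by_cases hu : ∃ u, m ≤ k ∧ ∀ α ∈ i.1.Γ \ R, u ∈ h α k
    · obtain ⟨u, hk, hu⟩ := hu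
      refine ⟨some u, fun v => ⟨?_, fun hv => ?_⟩⟩
      · rintro ⟨⟩
        exact ⟨hk, hu⟩
      · obtain ⟨α, hα⟩ := hne i.1 i.2
        exact congrArg some (Part.mem_unique (hu α hα) (hv.2 α hα))
    · push Not at hu
      refine ⟨none, fun u => ⟨fun h => by simp at h, fun h => ?_⟩⟩
      obtain ⟨α, hα, hn⟩ := hu u h.1
      exact absurd (h.2 α hα) hn
  choose f hf using hfex
  -- The least index is taken because its function is contained modulo finite in all the others.
  let a : T → Omega1 := fun i => (i.1.Γ \ R).min' (hne i.1 i.2)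
  have hamem : ∀ i : T, a i ∈ i.1.Γ \ R := fun i => Finset.min'_mem _ _
  have ha : ∀ δ, {i | a i ≤ δ}.Countable := by
    intro δ
    refine Set.Countable.mono ?_ ((((Omega1.countable_Iic δ).mono
      (Set.sep_subset _ (· ∉ R))).biUnion fun b hb => hroot b hb.2).preimage
        Subtype.val_injective)
    intro i hi
    have := Finset.mem_sdiff.1 (hamem i)
    exact Set.mem_biUnion (x := a i) ⟨hi, this.2⟩ ⟨i.2, this.1⟩
  have hfin : ∀ i, {k | ∃ u ∈ h (a i) k, f i k ≠ some u}.Finite := by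
    intro i
    refine ((Set.finite_Iio m).union ((i.1.Γ \ R).finite_toSet.biUnion fun α hα =>
      finite_setOf_mem_notMem hcoh hdom (show a i ≤ α from Finset.min'_le _ α hα))).subset ?_
    rintro k ⟨u, hu, hn⟩
    rw [Ne, hf, not_and_or, not_le] at hn
    refine hn.imp id fun hn => ?_
    push Not at hn
    obtain ⟨α, hα, hn⟩ := hn
    exact Set.mem_biUnion hα ⟨u, hu, hn⟩
  -- One point of disagreement for each of the `2 ^ (n + 1)` nodes of the new level.
  obtain ⟨i, j, hij⟩ := exists_le_encard_ne hcoh hdom hext a ha f hfin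
    (2 ^ (n + 1))
  obtain ⟨e, he, hinj⟩ := exists_injOn_length hij
  have hne' : i.1 ≠ j.1 := by
    intro hij'
    obtain rfl : i = j := Subtype.ext hij'
    obtain ⟨u, v, hu, hv, huv⟩ := he (List.replicate (n + 1) true) (by simp)
    exact huv (Option.some.inj (hu.symm.trans hv))
  have hin := hSn i.1 (hTS i.2)
  have hsij := hSs i.1 (hTS i.2) j.1 (hTS j.2)
  have hold : ∀ r ∈ T, ∀ α ∈ r.Γ, ∀ β ∈ r.Γ, α ≠ β → ∀ ρ : List Bool, ρ.length = n + 1 →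
      ¬ IsFunctionGraph (unionRestrict (h α) (h β)
        (insert (e ρ) (i.1.s (ρ.take i.1.n)) : Finset ℕ)) := by
    intro r hr α hα β hβ hαβ ρ hρ hfun
    refine r.not_function α hα β hβ hαβ (ρ.take n) (by simp [hρ, hSn r (hTS hr)])
      (IsFunctionGraph.mono hfun (unionRestrict_mono ?_))
    rw [hin, hSs r (hTS hr) i.1 (hTS i.2)]
    exact Finset.coe_subset.2 (Finset.subset_insert _ _)
  have hcross : ∀ α ∈ i.1.Γ \ R, ∀ β ∈ j.1.Γ \ R, ∀ ρ : List Bool, ρ.length = n + 1 →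
      ∃ u v, u ∈ h α (e ρ) ∧ v ∈ h β (e ρ) ∧ u ≠ v := by
    intro α hα β hβ ρ hρ
    obtain ⟨u, v, hu, hv, huv⟩ := he ρ hρ
    exact ⟨u, v, ((hf i _ u).1 hu).2 α hα, ((hf j _ v).1 hv).2 β hβ, huv⟩
  obtain ⟨q, hqi, hqn, hqΓ, hqs, -⟩ := i.1.exists_extension e (i.1.Γ ∪ j.1.Γ)
    Finset.subset_union_left (by rwa [hin]) (by
      intro ρ hρ σ hmem
      obtain ⟨u, v, hu, -⟩ := he ρ (hin ▸ hρ)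
      rw [hSs i.1 (hTS i.2) q₀ (hTS hq₀)] at hmem
      exact absurd (hm σ _ hmem) (not_lt.2 ((hf i _ u).1 hu).1)) (by
      intro α hα β hβ hαβ ρ hρ
      rw [hin] at hρ
      rw [Finset.mem_union] at hα hβ
      by_cases hi : α ∈ i.1.Γ ∧ β ∈ i.1.Γ
      · exact hold i.1 i.2 α hi.1 β hi.2 hαβ ρ hρ
      by_cases hj : α ∈ j.1.Γ ∧ β ∈ j.1.Γ
      · exact hold j.1 j.2 α hj.1 β hj.2 hαβ ρ hρ
      have hRi := @(hR i.1 i.2)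
      have hRj := @(hR j.1 j.2)
      -- The remaining indices come from different conditions; a root element would put both into
      -- the same one.
      have hαR : α ∉ R := fun h => by have := hRi h; have := hRj h; tauto
      have hβR : β ∉ R := fun h => by have := hRi h; have := hRj h; tauto
      intro hfun
      have hmem : e ρ ∈ ((insert (e ρ) (i.1.s (ρ.take i.1.n)) : Finset ℕ) : Set ℕ) := by simp
      by_cases hαi : α ∈ i.1.Γ
      · obtain ⟨u, v, hu, hv, huv⟩ := hcross α (Finset.mem_sdiff.2 ⟨hαi, hαR⟩) β
          (Finset.mem_sdiff.2 ⟨by tauto, hβR⟩) ρ hρ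
        exact huv (hfun _ _ _ ⟨hmem, .inl hu⟩ ⟨hmem, .inr hv⟩)
      · obtain ⟨u, v, hu, hv, huv⟩ := hcross β (Finset.mem_sdiff.2 ⟨by tauto, hβR⟩) α
          (Finset.mem_sdiff.2 ⟨by tauto, hαR⟩) ρ hρ
        exact huv (hfun _ _ _ ⟨hmem, .inr hu⟩ ⟨hmem, .inl hv⟩))
  refine hA i.1 (hTS i.2).1 j.1 (hTS j.2).1 hne' ⟨q, hqi, ?_, ?_, fun ρ hρ => ?_⟩
  · rw [hqn, hin, hSn j.1 (hTS j.2)]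
    omega
  · rw [hqΓ]
    exact Finset.subset_union_right
  · rw [hqs ρ (by rw [hρ, hin, hSn j.1 (hTS j.2)]), hsij]

end QPoset

/-! ### Branches through the tree and density arguments. -/

/-- The initial segment of length `n` of an infinite binary sequence. -/
def branch (x : ℕ → Bool) (n : ℕ) : List Bool := (List.range n).map x

theorem length_branch (x : ℕ → Bool) (n : ℕ) : (branch x n).length = n := by simp [branch]

theorem take_branch (x : ℕ → Bool) {j n : ℕ} (hj : j ≤ n) : (branch x n).take j = branch x j := by
  rw [branch, ← List.map_take, List.take_range, min_eq_left hj, branch]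

theorem branch_eq_iff {x y : ℕ → Bool} {n : ℕ} : branch x n = branch y n ↔ ∀ i < n, x i = y i := by
  simp [branch]

namespace QPoset

variable {h : Omega1 → (ℕ →. ℕ)}

theorem s_branch_subset (r : QPoset h) (x : ℕ → Bool) {j : ℕ} (hj : j ≤ r.n) :
    r.s (branch x j) ⊆ r.s (branch x r.n) := by
  have := r.increasing (branch x r.n) (length_branch x _) j r.n hj le_rfl
  rwa [take_branch x hj, take_branch x le_rfl] at this

theorem s_branch_mono {q r : QPoset h} (hqr : q ≤ r) (x : ℕ → Bool) :
    r.s (branch x r.n) ⊆ q.s (branch x q.n) := by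
  rw [← s_eq_of_le hqr _ (length_branch x _).le]
  exact q.s_branch_subset x hqr.1

/-- The bound `d` is the first place where the branches differ; it does not depend on the condition,
so the intersection is frozen once `n` exceeds it. -/
theorem exists_inter_branch_eq {x y : ℕ → Bool} (hxy : x ≠ y) :
    ∃ d, ∀ r : QPoset h, d < r.n →
      r.s (branch x r.n) ∩ r.s (branch y r.n) = r.s (branch x d) := by
  classical
  have hex := Function.ne_iff.1 hxy
  refine ⟨Nat.find hex, fun r hd => ?_⟩
  have := r.inter_eq (branch x r.n) (branch y r.n) (length_branch _ _) (length_branch _ _)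
    (Nat.find hex) ⟨⟨hd.le, ?_⟩, ?_⟩
  · rwa [take_branch x hd.le] at this
  · rw [take_branch x hd.le, take_branch y hd.le, branch_eq_iff]
    exact fun i hi => not_not.1 (Nat.find_min hex hi)
  · rintro i ⟨hi, hi'⟩
    rw [take_branch x hi, take_branch y hi, branch_eq_iff] at hi'
    by_contra hc
    exact Nat.find_spec hex (hi' _ (not_le.1 hc))

/-- Enlarging a set cannot turn a non-function into a function, so with `Γ` unchanged the new points
may be chosen freely. -/
theorem exists_grow (r : QPoset h) (N : ℕ) :
    ∃ q ≤ r, q.n = r.n + 1 ∧ ∀ x, ∃ k ∈ q.s (branch x q.n), N ≤ k := by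
  obtain ⟨m, hm⟩ := r.exists_bound
  obtain ⟨e, he, hinj⟩ := exists_injOn_length (n := r.n + 1) (D := Set.Ici (max m N))
    (by rw [(Set.Ici_infinite _).encard_eq]; exact le_top)
  obtain ⟨q, hqr, hn, -, -, hs⟩ := r.exists_extension e r.Γ subset_rfl hinj
    (fun ρ hρ σ hmem => absurd (hm σ _ hmem) (not_lt.2 ((le_max_left _ _).trans (he ρ hρ))))
    (fun α hα β hβ hne ρ hρ hfun => r.not_function α hα β hβ hne (ρ.take r.n) (by simp [hρ])
      (IsFunctionGraph.mono hfun (unionRestrict_mono (by simp))))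
  refine ⟨q, hqr, hn, fun x => ⟨e (branch x q.n), ?_, ?_⟩⟩
  · rw [hs _ (by rw [length_branch, hn])]
    exact Finset.mem_insert_self _ _
  · exact (le_max_right _ _).trans (he _ (by rw [length_branch, hn]))

theorem exists_le_n (r : QPoset h) (m : ℕ) : ∃ q ≤ r, m ≤ q.n := by
  induction m with
  | zero => exact ⟨r, le_rfl, Nat.zero_le _⟩
  | succ m ih =>
    obtain ⟨q, hq, hm⟩ := ih
    obtain ⟨q', hq', hn, -⟩ := q.exists_grow 0
    exact ⟨q', hq'.trans hq, by omega⟩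

theorem exists_le_card (r : QPoset h) (x : ℕ → Bool) (m : ℕ) :
    ∃ q ≤ r, m ≤ (q.s (branch x q.n)).card := by
  induction m with
  | zero => exact ⟨r, le_rfl, Nat.zero_le _⟩
  | succ m ih =>
    obtain ⟨q, hq, hm⟩ := ih
    obtain ⟨N, hN⟩ := q.exists_bound
    obtain ⟨q', hq', hn, hk⟩ := q.exists_grow N
    obtain ⟨k, hk, hNk⟩ := hk x
    refine ⟨q', hq'.trans hq, hm.trans_lt (Finset.card_lt_card ?_)⟩
    refine Finset.ssubset_iff_subset_ne.2 ⟨s_branch_mono hq' x, fun heq => ?_⟩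
    exact absurd (hN _ k (heq ▸ hk)) (not_lt.2 hNk)

/-- The condition with `n = 0` and `Γ = {α}`. -/
def single (h : Omega1 → (ℕ →. ℕ)) (α : Omega1) : QPoset h where
  n := 0
  s _ := ∅
  Γ := {α}
  s_out _ _ := rfl
  not_function β hβ γ hγ hne := by
    rw [Finset.mem_singleton] at hβ hγ
    exact absurd (hβ.trans hγ.symm) hne
  increasing _ _ _ _ _ _ := subset_rfl
  inter_eq _ _ _ _ _ _ := Finset.inter_self _

/-! ### The generic index set and the generic almost disjoint family. -/

/-- The name for the union of the sets `Γ` of the conditions in the generic filter. -/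
noncomputable def genericΓ (h : Omega1 → (ℕ →. ℕ)) : PName (QPoset h) :=
  PName.mk {t : Omega1 × QPoset h // t.1 ∈ t.2.Γ} (fun t => checkElem _ t.1.1) fun t => t.1.2

/-- The name for the union of the sets `s (x ↾ n)` of the conditions in the generic filter. -/
noncomputable def genericBranch (h : Omega1 → (ℕ →. ℕ)) (x : ℕ → Bool) : PName (QPoset h) :=
  PName.mk {t : ℕ × QPoset h // t.1 ∈ t.2.s (branch x t.2.n)} (fun t => checkElem _ t.1.1)
    fun t => t.1.2

/-- The name for the family of the sets along the branches of the ground model. -/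
noncomputable def genericFamily (h : Omega1 → (ℕ →. ℕ)) : PName (QPoset h) :=
  PName.ofFamily (genericBranch h)

theorem forcesMem_genericΓ {z : PName (QPoset h)} {p : QPoset h} :
    ForcesMem z (genericΓ h) p ↔ ∀ q ≤ p, ∃ r ≤ q, ∃ α ∈ r.Γ, ForcesEq z (checkElem _ α) r := by
  refine forall_congr' fun q => forall_congr' fun _ => ⟨?_, ?_⟩
  · rintro ⟨r, hr, ⟨⟨α, r'⟩, hα⟩, hr', e⟩
    exact ⟨r, hr, α, hr'.2.1 hα, e⟩
  · rintro ⟨r, hr, α, hα, e⟩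
    exact ⟨r, hr, ⟨(α, r), hα⟩, le_rfl, e⟩

theorem forcesMem_genericBranch {x : ℕ → Bool} {z : PName (QPoset h)} {p : QPoset h} :
    ForcesMem z (genericBranch h x) p ↔
      ∀ q ≤ p, ∃ r ≤ q, ∃ k ∈ r.s (branch x r.n), ForcesEq z (checkElem _ k) r := by
  refine forall_congr' fun q => forall_congr' fun _ => ⟨?_, ?_⟩
  · rintro ⟨r, hr, ⟨⟨k, r'⟩, hk⟩, hr', e⟩
    exact ⟨r, hr, k, s_branch_mono hr' x hk, e⟩
  · rintro ⟨r, hr, k, hk, e⟩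
    exact ⟨r, hr, ⟨(k, r), hk⟩, le_rfl, e⟩

theorem forcesMem_genericBranch_of_mem {x : ℕ → Bool} {p : QPoset h} {k : ℕ}
    (hk : k ∈ p.s (branch x p.n)) : ForcesMem (checkElem _ k) (genericBranch h x) p :=
  forcesMem_genericBranch.2 fun q hq => ⟨q, le_rfl, k, s_branch_mono hq x hk, ForcesEq.refl _ _⟩

theorem forcesMem_genericFamily {z : PName (QPoset h)} {p : QPoset h} :
    ForcesMem z (genericFamily h) p ↔ ∀ q ≤ p, ∃ r ≤ q, ∃ x, ForcesEq z (genericBranch h x) r :=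
  forcesMem_ofFamily

/-- Members common to two distinct branches are decided to be below a fixed bound. -/
theorem exists_bound_of_ne {x y : ℕ → Bool} (hxy : x ≠ y) (p : QPoset h) :
    ∃ p' ≤ p, ∃ N : ℕ, ∀ z, ∀ q ≤ p', ForcesMem z (genericBranch h x) q →
      ForcesMem z (genericBranch h y) q → ∃ r ≤ q, ∃ k < N, ForcesEq z (checkElem _ k) r := by
  obtain ⟨d, hd⟩ := exists_inter_branch_eq (h := h) hxy
  obtain ⟨p', hp', hdn⟩ := p.exists_le_n (d + 1)
  obtain ⟨N, hN⟩ := p'.exists_bound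
  refine ⟨p', hp', N, fun z q hq hx hy => ?_⟩
  obtain ⟨r, hr, k, hk, e⟩ := forcesMem_genericBranch.1 hx q le_rfl
  obtain ⟨r', hr', k', hk', e'⟩ := forcesMem_genericBranch.1 hy r hr
  obtain rfl := checkElem_injective ((e.mono hr').symm.trans e')
  have hrp := hr'.trans (hr.trans hq)
  have hmem : k ∈ r'.s (branch x r'.n) ∩ r'.s (branch y r'.n) :=
    Finset.mem_inter.2 ⟨s_branch_mono hr' x hk, hk'⟩
  rw [hd r' (lt_of_lt_of_le hdn hrp.1),
    s_eq_of_le hrp _ ((length_branch x d).le.trans (by omega))] at hmem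
  exact ⟨r', hr'.trans hr, k, hN _ _ hmem, e'⟩

/-- The intersection is bounded by some `N`, whereas a point at or above `N` can always be added
along `x`. -/
theorem genericBranch_injective {x y : ℕ → Bool} (hxy : x ≠ y) (p : QPoset h) :
    ¬ ForcesEq (genericBranch h x) (genericBranch h y) p := by
  intro e
  obtain ⟨p', hp', N, hN⟩ := exists_bound_of_ne hxy p
  obtain ⟨q, hq, -, hk⟩ := p'.exists_grow N
  obtain ⟨k, hk, hNk⟩ := hk x
  have hx := forcesMem_genericBranch_of_mem hk
  obtain ⟨r, hr, k', hk', e'⟩ := hN _ q hq hx (hx.congr_right (e.mono (hq.trans hp')))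
  rw [checkElem_injective e'] at hNk
  omega

theorem forces_subset_genericΓ (p : QPoset h) :
    Forces p (.subset (genericΓ h) (checkOrd _ Omega1)) := by
  refine forces_allIn.2 fun z q _ hz => forcesMem_ofFamily.2 fun q' hq' => ?_
  obtain ⟨r, hr, α, -, e⟩ := forcesMem_genericΓ.1 hz q' hq'
  exact ⟨r, hr, α, e⟩

theorem forces_genericBranch_subset {x : ℕ → Bool} {a : PName (QPoset h)} {p : QPoset h}
    (ha : ForcesEq a (genericBranch h x) p) : Forces p (.subset a (checkOrd _ ℕ)) := by
  refine forces_allIn.2 fun z q hq hz => forcesMem_ofFamily.2 fun q' hq' => ?_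
  obtain ⟨r, hr, k, -, e⟩ := forcesMem_genericBranch.1 (hz.congr_right (ha.mono hq)) q' hq'
  exact ⟨r, hr, k, e⟩

theorem forces_genericBranch_infinite {x : ℕ → Bool} {a : PName (QPoset h)} {p : QPoset h}
    (ha : ForcesEq a (genericBranch h x) p) :
    Forces p (.neg (.finite (checkOrd _ ℕ) fun n => .mem n a)) := by
  intro q hq hfin
  obtain ⟨q₁, hq₁, k, hk, hf⟩ := forces_exIn.1 hfin q le_rfl
  obtain ⟨q₂, hq₂, f, hf⟩ := forces_ex.1 hf q₁ le_rfl
  obtain ⟨q₃, hq₃, m, hkm⟩ := forcesMem_ofFamily.1 hk q₂ hq₂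
  obtain ⟨q₄, hq₄, hcard⟩ := q₃.exists_le_card x (m + 1)
  obtain ⟨hsv, hcov⟩ := forces_coveredBy.1 (hf.mono (hq₄.trans hq₃))
  have haq := ha.mono (hq₄.trans (hq₃.trans (hq₂.trans (hq₁.trans hq))))
  -- Pigeonhole: `q₄` already puts `m + 1` numbers into the set. Deciding an index below `m` for
  -- each in turn gives two of them the same index, against single-valuedness.
  have hstep : ∀ S ⊆ q₄.s (branch x q₄.n), ∃ r ≤ q₄, ∀ n ∈ S, ∃ j < m,
      ForcesMem (opair (checkElem _ j) (checkElem _ n)) f r := by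
    intro S
    induction S using Finset.induction_on with
    | empty => exact fun _ => ⟨q₄, le_rfl, by simp⟩
    | insert n S _ ih =>
      intro hS
      obtain ⟨r, hr, hrS⟩ := ih fun i hi => hS (Finset.mem_insert_of_mem hi)
      have hn : ForcesMem (checkElem _ n) a r :=
        ((forcesMem_genericBranch_of_mem (hS (Finset.mem_insert_self n S))).congr_right
          haq.symm).mono hr
      obtain ⟨r₁, hr₁, i, hik, hi⟩ := hcov _ r hr hn
      obtain ⟨r₂, hr₂, j, hj, e⟩ := forcesMem_checkElem.1
        (hik.congr_right (hkm.mono (hr₁.trans (hr.trans hq₄)))) r₁ le_rfl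
      refine ⟨r₂, hr₂.trans (hr₁.trans hr), fun l hl => ?_⟩
      rcases Finset.mem_insert.1 hl with rfl | hl
      · exact ⟨j, hj, exists_forcesMem_opair_checkElem (hi.mono hr₂) e⟩
      · obtain ⟨j, hj, hm⟩ := hrS l hl
        exact ⟨j, hj, hm.mono (hr₂.trans hr₁)⟩
  obtain ⟨r, hr, hrS⟩ := hstep _ subset_rfl
  choose! g hg hm using hrS
  obtain ⟨i, hi, j, hj, hij, heq⟩ := Finset.exists_ne_map_eq_of_card_lt_of_maps_to
    (t := Finset.range m) (by simpa using hcard) (fun n hn => Finset.mem_range.2 (hg n hn))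
  exact hij (checkElem_injective (hsv _ _ _ r hr (hm i hi) (heq ▸ hm j hj)))

theorem forces_finite_inter {x y : ℕ → Bool} (hxy : x ≠ y) {a b : PName (QPoset h)} {p : QPoset h}
    (ha : ForcesEq a (genericBranch h x) p) (hb : ForcesEq b (genericBranch h y) p) :
    Forces p (.finite (checkOrd _ ℕ) fun n => .and (.mem n a) (.mem n b)) := by
  refine Forces.of_dense fun q hq => ?_
  obtain ⟨p', hp', N, hN⟩ := exists_bound_of_ne hxy q
  -- The covering function is the identity on `N`.
  refine ⟨p', hp', forces_exIn.2 fun q₁ hq₁ => ⟨q₁, le_rfl, checkElem _ N,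
    forcesMem_ofFamily_self _ N _, Forces.ex
      (.ofFamily fun i : Fin N => opair (checkElem _ (i : ℕ)) (checkElem _ (i : ℕ)))
      (forces_coveredBy.2 ⟨?_, ?_⟩)⟩⟩
  · intro u v w q₂ _ hv hw
    refine ForcesEq.of_dense fun q₃ hq₃ => ?_
    obtain ⟨r, hr, i, e⟩ := forcesMem_ofFamily.1 hv q₃ hq₃
    obtain ⟨r', hr', j, e'⟩ := forcesMem_ofFamily.1 hw r (hr.trans hq₃)
    have e := e.mono hr'
    exact ⟨r', hr'.trans hr, e.opair_snd.trans
      ((e.opair_fst.symm.trans e'.opair_fst).trans e'.opair_snd.symm)⟩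
  · rintro z q₂ hq₂ ⟨hza, hzb⟩
    have hqp := (hq₂.trans hq₁).trans (hp'.trans hq)
    obtain ⟨r, hr, k, hk, e⟩ := hN z q₂ (hq₂.trans hq₁) (hza.congr_right (ha.mono hqp))
      (hzb.congr_right (hb.mono hqp))
    refine ⟨r, hr, checkElem _ k, forcesMem_checkElem_of_lt hk r, ?_⟩
    exact (forcesMem_ofFamily_self (fun i : Fin N =>
      opair (checkElem _ (i : ℕ)) (checkElem _ (i : ℕ))) ⟨k, hk⟩ r).congr_left
        ((ForcesEq.refl _ _).opair e.symm)

theorem forces_almostDisjointFamily (p : QPoset h) :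
    Forces p (.almostDisjointFamily (checkOrd _ ℕ) (genericFamily h)) := by
  refine ⟨forces_allIn.2 fun a q _ ha => Forces.of_dense fun q' hq' => ?_,
    forces_allIn.2 fun a q _ ha => forces_allIn.2 fun b q₁ hq₁ hb => forces_imp.2
      fun q₂ hq₂ hne => Forces.of_dense fun q₃ hq₃ => ?_⟩
  · obtain ⟨r, hr, x, e⟩ := forcesMem_genericFamily.1 ha q' hq'
    exact ⟨r, hr, forces_genericBranch_subset e, forces_genericBranch_infinite e⟩
  · obtain ⟨r, hr, x, e⟩ := forcesMem_genericFamily.1 ha q₃ (hq₃.trans (hq₂.trans hq₁))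
    obtain ⟨r', hr', y, e'⟩ := forcesMem_genericFamily.1 hb r (hr.trans (hq₃.trans hq₂))
    have e := e.mono hr'
    refine ⟨r', hr'.trans hr, forces_finite_inter ?_ e e'⟩
    rintro rfl
    exact hne r' (hr'.trans (hr.trans hq₃)) (e.trans e'.symm)

theorem forces_mem_inUnionRestrict {α β a : PName (QPoset h)} {α₀ β₀ : Omega1} {x : ℕ → Bool}
    {p : QPoset h} (hα : ForcesEq α (checkElem _ α₀) p) (hβ : ForcesEq β (checkElem _ β₀) p)
    (ha : ForcesEq a (genericBranch h x) p) {n k : ℕ}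
    (hnk : (n, k) ∈ unionRestrict (h α₀) (h β₀) (p.s (branch x p.n))) :
    Forces p (.inUnionRestrict (checkSeq _ h) α β a (checkElem _ n) (checkElem _ k)) := by
  refine ⟨(forcesMem_genericBranch_of_mem hnk.1).congr_right ha.symm, Forces.or ?_⟩
  have key : ∀ {γ : PName (QPoset h)} {γ₀ : Omega1}, ForcesEq γ (checkElem _ γ₀) p →
      k ∈ h γ₀ n → ForcesMem (opair γ (opair (checkElem _ n) (checkElem _ k))) (checkSeq _ h) p :=
    fun {γ γ₀} e hk => (forcesMem_ofFamily_self
      (fun t : {t : Omega1 × ℕ × ℕ // t.2.2 ∈ h t.1 t.2.1} => opair (checkElem (QPoset h) t.1.1)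
        (opair (checkElem _ t.1.2.1) (checkElem _ t.1.2.2))) ⟨(γ₀, n, k), hk⟩ p).congr_left
          (e.symm.opair (ForcesEq.refl _ _))
  exact hnk.2.imp (key hα) (key hβ)

/-- Once two indices are decided to lie in `Γ` of a single condition, its clause `not_function` at
the top node on `x` already shows two values at one point of the set. -/
theorem forces_luzinIncoherent {x : ℕ → Bool} {a : PName (QPoset h)} {p : QPoset h}
    (ha : ForcesEq a (genericBranch h x) p) :
    Forces p (.luzinIncoherent (checkSeq _ h) (genericΓ h) a) := by
  refine forces_allIn.2 fun α q hq hα => forces_allIn.2 fun β q₁ hq₁ hβ => forces_imp.2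
    fun q₂ hq₂ hlt q₃ hq₃ hsv => ?_
  obtain ⟨r, hr, α₀, hα₀, e⟩ := forcesMem_genericΓ.1 hα q₃ (hq₃.trans (hq₂.trans hq₁))
  obtain ⟨r', hr', β₀, hβ₀, e'⟩ := forcesMem_genericΓ.1 hβ r (hr.trans (hq₃.trans hq₂))
  have e := e.mono hr'
  have hr'₃ := hr'.trans hr
  have hne : α₀ ≠ β₀ := by
    rintro rfl
    exact not_forcesMem_checkElem_self α₀ r'
      (((ForcesMem.mono hlt (hr'₃.trans hq₃)).congr_left e).congr_right e')
  refine r'.not_function α₀ (hr'.2.1 hα₀) β₀ hβ₀ hne (branch x r'.n) (length_branch _ _) ?_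
  intro n u v hu hv
  have ha' := ha.mono (hr'₃.trans (hq₃.trans (hq₂.trans (hq₁.trans hq))))
  exact checkElem_injective (forces_singleValued.1 hsv _ _ _ r' hr'₃
    (forces_mem_inUnionRestrict e e' ha' hu) (forces_mem_inUnionRestrict e e' ha' hv))

end QPoset

/-! ### Uncountability and the main theorem. -/

theorem not_countable_univ_nat_bool : ¬ (Set.univ : Set (ℕ → Bool)).Countable := by
  rw [← Cardinal.le_aleph0_iff_set_countable, Cardinal.mk_univ, not_le]
  simpa using Cardinal.cantor Cardinal.aleph0

theorem mainTheorem6 (h : Omega1 → (ℕ →. ℕ))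
    (hcoh : Coherent (Set.range h))
    (hdom : ModFiniteIncreasingDoms h)
    (hext : ¬ ∃ g : ℕ → ℕ, Coherent (Set.range h ∪ {(g : ℕ →. ℕ)})) :
    IsCCC (QPoset h) ∧
      ∃ q : QPoset h, Forces q (existsLuzinRestrictions (QPoset h) h) := by
  have hccc := QPoset.isCCC hcoh hdom hext
  refine ⟨hccc, ?_⟩
  -- Conditions are labelled by their `Γ`; each index occurs in `QPoset.single`, so the labels are
  -- uncountable in total.
  obtain ⟨q, hq⟩ := hccc.exists_forall_le_not_countable
    (fun p : QPoset h => (p.Γ : Set Omega1)) (fun p q hqp => hqp.2.1) fun hc => by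
      refine Omega1.not_countable_univ (hc.mono fun α _ => ?_)
      exact ⟨QPoset.single h α, by simp [QPoset.single]⟩
  refine ⟨q, Forces.ex (QPoset.genericΓ h) (Forces.ex (QPoset.genericFamily h)
    ⟨⟨QPoset.forces_subset_genericΓ q, fun p hp hc => ?_⟩,
      ⟨QPoset.forces_almostDisjointFamily q, fun p hp hc => ?_⟩, ?_⟩)⟩
  · obtain ⟨r, hr, f, hf⟩ := forces_ex.1 hc p le_rfl
    refine hq r (hr.trans hp) ((hccc.countable_of_forces_coveredBy (checkElem (QPoset h))
      (fun α β hne p e => hne (checkElem_injective e)) hf).mono ?_)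
    rintro α ⟨r', hr', hα⟩
    exact ⟨r', hr', QPoset.forcesMem_genericΓ.2 fun t ht =>
      ⟨t, le_rfl, α, ht.2.1 hα, ForcesEq.refl _ _⟩⟩
  -- Every ground model branch set is forced into the family and distinct ones are never equal, so a
  -- countable cover would make `ℕ → Bool` countable.
  · obtain ⟨r, -, f, hf⟩ := forces_ex.1 hc p le_rfl
    refine not_countable_univ_nat_bool ((hccc.countable_of_forces_coveredBy (QPoset.genericBranch h)
      (fun x y hne p => QPoset.genericBranch_injective hne p) hf).mono fun x _ => ?_)
    exact ⟨r, le_rfl, forcesMem_ofFamily_self (QPoset.genericBranch h) x r⟩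
  · refine forces_allIn.2 fun a p _ ha => Forces.of_dense fun p' hp' => ?_
    obtain ⟨r, hr, x, e⟩ := QPoset.forcesMem_genericFamily.1 ha p' hp'
    exact ⟨r, hr, QPoset.forces_luzinIncoherent e⟩
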